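/- Let $k\ge 4$, let $X=\{0,\dots,k-1\}$, and let $T$ be the $k$-regular rooted tree of finite words over $X$, ordered by the prefix relation; its automorphisms act on the set of infinite words over $X$. For $i,j\in X$, $i<j$, let $a_{(ij)}$ be the automorphism of $T$ that fixes the empty word and is given recursively by $a_{(ij)}(iw)=jw$, $a_{(ij)}(jw)=iw$, and $a_{(ij)}(xw)=x\,a_{(ij)}(w)$ for $x\notin\{i,j\}$. Let $S=\{a_{(ij)} : 0\le i<j\le k-1\}$ and let $H^{(k)}=\langle S\rangle$ be the Hanoi Towers group on $k$ pegs. Let $\Gamma=\Gamma_{000\dots}$ be the orbital Schreier graph of the infinite word $\xi=000\dots$: its vertices are the left cosets $gP$ of the stabilizer $P=\mathrm{Stab}_{H^{(k)}}(\xi)$ (equivalently, the points $g\xi$ of the orbit of $\xi$), and each vertex $u$ is joined to $su$ for $s\in S$. For $n\ge 0$ let $\gamma(n)$ be the number of vertices of $\Gamma$ at distance at most $n$ from the base vertex $P$ (equivalently, from $\xi$). For functions $f,g$ of $n\in\{0,1,2,\dots\}$ write $f\preceq g$ if there is a positive integer $C$ such that $f(n)\le g(Cn)$ for all $n\ge 0$.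 **Theorem.** The growth of $\Gamma$ is intermediate, i.e. $\lim_{n\to\infty}\sqrt[n]{\gamma(n)}=1$ and $n^m\preceq\gamma(n)$ for every real $m>0$. Moreover, there are constants $b>a>1$ (which may depend on $k$) such that $$a^{(\log n)^{k-2}}\preceq\gamma(n)\preceq b^{(\log n)^{k-2}},$$ where at $n=0$ the expression $\log n$ is read as $0$. -/

import Mathlib

open Filter Topology

theorem perm_apply_inv {α : Type} (g : Equiv.Perm α) (x : α) : g (g⁻¹ x) = x :=
  g.apply_symm_apply x

/-- The group of automorphisms of the rooted tree of finite words over `X`: the permutations of the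
set of words that preserve the level (the length) and the prefix order. -/
def treeAut (X : Type) : Subgroup (Equiv.Perm (List X)) where
  carrier := {g | (∀ u, (g u).length = u.length) ∧ ∀ u v, g u <+: g v ↔ u <+: v}
  one_mem' := ⟨fun _ => rfl, fun _ _ => Iff.rfl⟩
  mul_mem' := by
    rintro g h ⟨hg, hg'⟩ ⟨hh, hh'⟩
    refine ⟨fun u => ?_, fun u v => ?_⟩
    · rw [Equiv.Perm.mul_apply, hg, hh]
    · rw [Equiv.Perm.mul_apply, Equiv.Perm.mul_apply, hg', hh']
  inv_mem' := by
    rintro g ⟨hg, hg'⟩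
    refine ⟨fun u => ?_, fun u v => ?_⟩
    · rw [← hg, perm_apply_inv]
    · rw [← hg', perm_apply_inv, perm_apply_inv]

/-- The boundary of the tree of words over `X`: the infinite words. -/
def Boundary (X : Type) : Type := ℕ → X

/-- The prefix of length `n` of an infinite word. -/
def Boundary.take {X : Type} (ξ : Boundary X) (n : ℕ) : List X := (List.range n).map fun i => ξ i

theorem Boundary.length_take {X : Type} (ξ : Boundary X) (n : ℕ) : (ξ.take n).length = n := by
  simp [Boundary.take]

theorem Boundary.take_prefix {X : Type} (ξ : Boundary X) {m n : ℕ} (h : m ≤ n) :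
    ξ.take m <+: ξ.take n := by
  obtain ⟨d, rfl⟩ := Nat.exists_eq_add_of_le h
  refine ⟨(List.range d).map (fun i => ξ (m + i)), ?_⟩
  simp [Boundary.take, List.range_add, Function.comp_def]

theorem Boundary.ext_take {X : Type} {ξ η : Boundary X} (h : ∀ n, ξ.take n = η.take n) :
    ξ = η := by
  funext n
  have h1 := congrArg (fun l => l[n]?) (h (n + 1))
  simpa [Boundary.take] using h1

/-- The infinite word `xxx…`. -/
def constRay {X : Type} (x : X) : Boundary X := fun _ => x

/-- The image of an infinite word `ξ` under a tree automorphism `g`: its letter at position `n` is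
the last letter of the image under `g` of the prefix of length `n + 1` of `ξ`. -/
def boundaryMap {X : Type} (g : treeAut X) (ξ : Boundary X) : Boundary X := fun n =>
  ((g : Equiv.Perm (List X)) (ξ.take (n + 1)))[n]'(by
    rw [g.2.1, Boundary.length_take]; exact Nat.lt_succ_self n)

/-- The prefixes of the image of an infinite word are the images of its prefixes. -/
theorem take_boundaryMap {X : Type} (g : treeAut X) (ξ : Boundary X) (n : ℕ) :
    (boundaryMap g ξ).take n = (g : Equiv.Perm (List X)) (ξ.take n) := by
  apply List.ext_getElem
  · rw [g.2.1, Boundary.length_take, Boundary.length_take]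
  · intro i h1 h2
    rw [Boundary.length_take] at h1
    have hp : (g : Equiv.Perm (List X)) (ξ.take (i + 1)) <+:
        (g : Equiv.Perm (List X)) (ξ.take n) :=
      (g.2.2 _ _).2 (ξ.take_prefix h1)
    have hl : i < ((g : Equiv.Perm (List X)) (ξ.take (i + 1))).length := by
      rw [g.2.1, Boundary.length_take]; exact Nat.lt_succ_self i
    rw [← hp.getElem hl]
    simp only [Boundary.take, List.getElem_map, List.getElem_range]
    rfl

/-- The action of the tree automorphisms on the boundary of the tree. -/
instance boundaryMulAction (X : Type) : MulAction (treeAut X) (Boundary X) where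
  smul := boundaryMap
  one_smul ξ := Boundary.ext_take fun n => take_boundaryMap 1 ξ n
  mul_smul g h ξ := Boundary.ext_take fun n => by
    change (boundaryMap (g * h) ξ).take n = (boundaryMap g (boundaryMap h ξ)).take n
    rw [take_boundaryMap, take_boundaryMap, take_boundaryMap]
    rfl

/-- The recursion `a_π = π (a_0, …, a_{k-1})`, where the section `a_x` is trivial if `x` lies in the
support of `π`, and is `a_π` itself otherwise. -/
def hanoiMap {k : ℕ} (π : Equiv.Perm (Fin k)) : List (Fin k) → List (Fin k)
  | [] => []
  | x :: w => π x :: (if π x ≠ x then w else hanoiMap π w)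

theorem hanoiMap_inv {k : ℕ} (π σ : Equiv.Perm (Fin k)) (h : ∀ x, σ (π x) = x)
    (u : List (Fin k)) : hanoiMap σ (hanoiMap π u) = u := by
  induction u with
  | nil => rfl
  | cons x w ih =>
    by_cases hx : π x = x
    · have h2 : σ x = x := by simpa [hx] using h x
      simp [hanoiMap, hx, h2, ih]
    · have h2 : ¬ x = π x := fun e => hx e.symm
      simp [hanoiMap, hx, h, h2]

theorem hanoiMap_length {k : ℕ} (π : Equiv.Perm (Fin k)) (u : List (Fin k)) :
    (hanoiMap π u).length = u.length := by
  induction u with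
  | nil => rfl
  | cons x w ih => by_cases hx : π x = x <;> simp [hanoiMap, hx, ih]

theorem hanoiMap_prefix {k : ℕ} (π : Equiv.Perm (Fin k)) (u v : List (Fin k)) :
    hanoiMap π u <+: hanoiMap π v ↔ u <+: v := by
  induction u generalizing v with
  | nil => simp [hanoiMap]
  | cons x w ih =>
    cases v with
    | nil => simp [hanoiMap]
    | cons y v =>
      simp only [hanoiMap, List.cons_prefix_cons, EmbeddingLike.apply_eq_iff_eq]
      refine and_congr_right fun e => ?_
      subst e
      by_cases hx : π x = x <;> simp [hx, ih]

/-- The tree automorphism `a_π` attached to a permutation `π` of the letters. -/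
def hanoiAut {k : ℕ} (π : Equiv.Perm (Fin k)) : treeAut (Fin k) :=
  ⟨{ toFun := hanoiMap π
     invFun := hanoiMap π⁻¹
     left_inv := hanoiMap_inv π π⁻¹ (fun x => by simp)
     right_inv := hanoiMap_inv π⁻¹ π (fun x => by simp) },
    hanoiMap_length π, hanoiMap_prefix π⟩

/-- The automorphisms `a_(ij)`, `0 ≤ i < j ≤ k - 1`. -/
def hanoiGenSet (k : ℕ) : Set (treeAut (Fin k)) :=
  {g | ∃ i j : Fin k, i < j ∧ g = hanoiAut (Equiv.swap i j)}

/-- The Hanoi Towers group on `k` pegs. -/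
def hanoiGroup (k : ℕ) : Subgroup (treeAut (Fin k)) := Subgroup.closure (hanoiGenSet k)

/-- The Schreier graph of a group `G` with respect to a subgroup `P` and a set `S`: the vertices are
the cosets of `P`, and each `u` is joined to `s • u` for `s ∈ S`. Loops and multiplicities of edges,
which have no influence on distances, are not recorded. -/
def schreierGraph {G : Type} [Group G] (P : Subgroup G) (S : Set G) : SimpleGraph (G ⧸ P) :=
  SimpleGraph.fromRel fun u v => ∃ s ∈ S, s • u = v

/-- The orbital Schreier graph of the Hanoi Towers group at an infinite word `ξ`: the Schreier graph
with respect to the stabilizer of `ξ` and the generators `a_(ij)`. -/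
def hanoiSchreierGraph (k : ℕ) (ξ : Boundary (Fin k)) :
    SimpleGraph (hanoiGroup k ⧸ MulAction.stabilizer (hanoiGroup k) ξ) :=
  schreierGraph (MulAction.stabilizer (hanoiGroup k) ξ)
    {s : hanoiGroup k | (s : treeAut (Fin k)) ∈ hanoiGenSet k}

/-- The number of vertices in the ball of radius `n` centered at `v`. -/
noncomputable def ballGrowth {V : Type} (Γ : SimpleGraph V) (v : V) (n : ℕ) : ℕ :=
  {u : V | Γ.edist v u ≤ (n : ℕ∞)}.ncard

/-- The growth function of the orbital Schreier graph at `ξ`; the base vertex, which corresponds to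
`ξ` itself, is the trivial coset. -/
noncomputable def hanoiGrowth (k : ℕ) (ξ : Boundary (Fin k)) (n : ℕ) : ℕ :=
  ballGrowth (hanoiSchreierGraph k ξ) ((1 : hanoiGroup k) : hanoiGroup k ⧸ _) n

/-- Asymptotic domination: `f n ≤ g (C n)` for all `n ≥ 0` and some `C > 0`. -/
def AsympLE (f g : ℕ → ℝ) : Prop := ∃ C : ℕ, 0 < C ∧ ∀ n : ℕ, f n ≤ g (C * n)

/-- Intermediate growth: the `n`-th root of `γ n` tends to `1`, and `γ` dominates every power. -/
def IntermediateGrowth (γ : ℕ → ℝ) : Prop :=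
  Tendsto (fun n : ℕ => γ n ^ (1 / (n : ℝ))) atTop (𝓝 1) ∧
    ∀ m : ℝ, 0 < m → AsympLE (fun n : ℕ => (n : ℝ) ^ m) γ

/-! An infinite word is a position of a Hanoi game with infinitely many disks: letter `i` is the peg
of disk `i`, disk `0` being the smallest. The generator of a transposition moves the smallest disk
lying on either of its two pegs to the other one, so distance in the Schreier graph is the number of
moves. Write `k = r + 2`. The theorem reduces to estimating how many disks can be disturbed in a
given number of moves, starting from all disks on one peg.

Upper bound: moving about `j ^ r` disks costs at least `2 ^ j` moves (`two_pow_le_of_forall_move`).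
Hence fewer than `2 ^ j` moves disturb only the first `O(j ^ r)` disks (`eq_of_lt_two_pow`), and the
ball has at most `k ^ O(j ^ r)` points.

Lower bound: the Frame–Stewart strategy moves a tower of `j.choose r` disks in at most `4 ^ j` moves
(`HanoiReach.tower`). Placing the disks one at a time, largest first, then gives all `k ^ (j.choose
r)` arrangements within `2 * 8 ^ j` moves (`HanoiReach.of_tower`).

Since `j.choose r` also has order `j ^ r`, taking `j` of order `log n` gives both bounds.
Intermediate growth follows because `(log n) ^ r` is `o(n)` and, as `r ≥ 2`, eventually exceeds
every multiple of `log n`. -/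

theorem exists_eq_of_succ_le {f : ℕ → ℕ} (hf : ∀ t, f (t + 1) ≤ f t + 1) {m a b : ℕ} (hab : a ≤ b)
    (ha : f a ≤ m) (hb : m ≤ f b) : ∃ t, a ≤ t ∧ t ≤ b ∧ f t = m := by
  induction b, hab using Nat.le_induction with
  | base => exact ⟨a, le_rfl, le_rfl, le_antisymm ha hb⟩
  | succ b hab ih =>
    by_cases h : m ≤ f b
    · obtain ⟨t, h1, h2, h3⟩ := ih h
      exact ⟨t, h1, h2.trans b.le_succ, h3⟩
    · exact ⟨b + 1, hab.trans b.le_succ, le_rfl, by have := hf b; omega⟩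

theorem Finset.exists_card_filter_lt_eq (D : Finset ℕ) {m : ℕ} (hm : m ≤ D.card) :
    ∃ N, (D.filter (· < N)).card = m := by
  have hf : ∀ N, (D.filter (· < N + 1)).card ≤ (D.filter (· < N)).card + 1 := by
    intro N
    refine (Finset.card_le_card (t := insert N (D.filter (· < N))) fun x hx => ?_).trans
      (Finset.card_insert_le _ _)
    simp only [Finset.mem_filter, Finset.mem_insert] at hx ⊢
    rcases Nat.lt_succ_iff_lt_or_eq.1 hx.2 with h | h
    · exact Or.inr ⟨hx.1, h⟩
    · exact Or.inl h
  obtain ⟨N, -, -, h⟩ := exists_eq_of_succ_le (f := fun N => (D.filter (· < N)).card) hf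
    (a := 0) (b := D.sup id + 1) (m := m) (Nat.zero_le _) (by simp) (by
      have : D.filter (· < D.sup id + 1) = D := Finset.filter_true_of_mem fun x hx =>
        Nat.lt_succ_of_le (Finset.le_sup (f := id) hx)
      simpa only [this] using hm)
  exact ⟨N, h⟩

/-! ### Moves of the Hanoi game -/

/-- A move of the Hanoi Towers game, possibly trivial, in which `u i` is the peg of disk `i` and
disk `i` is smaller than disk `i + 1`. -/
def HanoiStep {X : Type} (u v : ℕ → X) : Prop :=
  ∃ d, (∀ e, e ≠ d → v e = u e) ∧ (v d ≠ u d → ∀ e < d, u e ≠ u d ∧ u e ≠ v d)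

namespace HanoiStep

variable {X : Type} {u v : ℕ → X}

theorem refl (u : ℕ → X) : HanoiStep u u := ⟨0, fun _ _ => rfl, fun h => absurd rfl h⟩

theorem eq_of_ne (h : HanoiStep u v) {d e : ℕ} (hd : v d ≠ u d) (he : v e ≠ u e) : d = e := by
  obtain ⟨x, hx, -⟩ := h
  by_contra hde
  by_cases h1 : d = x
  · exact he (hx e fun h2 => hde (h1.trans h2.symm))
  · exact hd (hx d h1)

theorem ne_of_lt (h : HanoiStep u v) {d e : ℕ} (hd : v d ≠ u d) (he : e < d) :
    u e ≠ u d ∧ u e ≠ v d := by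
  obtain ⟨x, hx, hx'⟩ := h
  obtain rfl : d = x := by
    by_contra h1
    exact hd (hx d h1)
  exact hx' hd e he

end HanoiStep

theorem exists_move_of_ne {X : Type} {c : ℕ → ℕ → X} {d s e : ℕ} (hse : s ≤ e)
    (h : c e d ≠ c s d) : ∃ t, s ≤ t ∧ t < e ∧ c (t + 1) d ≠ c t d := by
  by_contra! hn
  apply h
  clear h
  induction e, hse using Nat.le_induction with
  | base => rfl
  | succ e hse ih =>
    rw [hn e hse e.lt_succ_self]
    exact ih fun t h1 h2 => hn t h1 (h2.trans e.lt_succ_self)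

/-! ### Lower bound for the number of moves -/

/-- While a disk rests on a peg, the larger disks that move stay off that peg. -/
theorem ne_of_forall_eq {X : Type} {c : ℕ → ℕ → X} (hc : ∀ t, HanoiStep (c t) (c (t + 1)))
    {s e x y : ℕ} {p : X} (hxy : x < y) (hx : ∀ t, s ≤ t → t ≤ e → c t x = p)
    (hy : ∃ t, s ≤ t ∧ t < e ∧ c (t + 1) y ≠ c t y) {t : ℕ} (h1 : s ≤ t) (h2 : t ≤ e) :
    c t y ≠ p := by
  -- A move of `y` neither starts nor ends at `p`, so lying on `p` is invariant for `y`; if it ever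
  -- held, `y` would stay on `p` and never move.
  have key : ∀ t, s ≤ t → t < e → (c t y = p ↔ c (t + 1) y = p) := by
    intro t h1 h2
    by_cases h : c (t + 1) y = c t y
    · rw [h]
    · have := (hc t).ne_of_lt h hxy
      rw [hx t h1 h2.le] at this
      exact iff_of_false this.1.symm this.2.symm
  have all : ∀ t, s ≤ t → t ≤ e → (c s y = p ↔ c t y = p) := by
    intro t h1
    induction t, h1 using Nat.le_induction with
    | base => exact fun _ => Iff.rfl
    | succ t h1 ih => exact fun h2 => (ih (by omega)).trans (key t h1 h2)
  obtain ⟨τ, h3, h4, h5⟩ := hy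
  intro h
  have h6 := (all t h1 h2).2 h
  exact h5 (((all _ (by omega) h4).1 h6).trans ((all _ h3 h4.le).1 h6).symm)

/-- If sufficiently many disks all move, with only `r + 2` pegs at their disposal, then it takes
at least `2 ^ j` moves. -/
theorem two_pow_le_of_forall_move {X : Type} [DecidableEq X] {c : ℕ → ℕ → X}
    (hc : ∀ t, HanoiStep (c t) (c (t + 1))) (r j : ℕ) {s e : ℕ} (P : Finset X) (D : Finset ℕ)
    (hP : P.card ≤ r + 2) (hD : 2 ^ (r + 1) * (j + 1) ^ r ≤ D.card)
    (hDP : ∀ d ∈ D, ∀ t, s ≤ t → t ≤ e → c t d ∈ P)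
    (hmove : ∀ d ∈ D, ∃ t, s ≤ t ∧ t < e ∧ c (t + 1) d ≠ c t d) : s + 2 ^ j ≤ e := by
  induction r generalizing j s e P D with
  | zero =>
    exfalso
    -- With two pegs, at most one disk can move: a move of the larger of two disks involves three
    -- distinct pegs, its own two and that of the smaller disk.
    obtain ⟨x, hx, y, hy, hxy⟩ := Finset.one_lt_card.1 (show 1 < D.card by simp at hD; omega)
    wlog hlt : x < y generalizing x y
    · exact this y hy x hx hxy.symm (by omega)
    obtain ⟨t, h1, h2, h3⟩ := hmove y hy
    have h4 := (hc t).ne_of_lt h3 hlt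
    have : ({c t x, c t y, c (t + 1) y} : Finset X).card ≤ P.card := by
      apply Finset.card_le_card
      simp only [Finset.insert_subset_iff, Finset.singleton_subset_iff]
      exact ⟨hDP x hx t h1 h2.le, hDP y hy t h1 h2.le, hDP y hy (t + 1) (by omega) h2⟩
    rw [Finset.card_eq_three.2 ⟨_, _, _, h4.1, h4.2, h3.symm, rfl⟩] at this
    omega
  | succ r ihr =>
    induction j generalizing s e P D with
    | zero =>
      obtain ⟨d, hd⟩ := Finset.card_pos.1 (lt_of_lt_of_le (by positivity) hD)
      obtain ⟨t, h1, h2, -⟩ := hmove d hd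
      simp; omega
    | succ j ihj =>
      -- This budget splits the disks into `m` small ones, enough for the induction on `j`, and `2 *
      -- l` large ones, `l` being enough for one peg fewer at the same exponent `j + 1`.
      have hnum : 2 ^ (r + 2) * (j + 1) ^ (r + 1) + 2 * (2 ^ (r + 1) * (j + 2) ^ r) ≤ D.card := by
        refine le_trans ?_ hD
        have : (j + 1) ^ r ≤ (j + 2) ^ r := Nat.pow_le_pow_left (by omega) r
        calc _ = 2 ^ (r + 2) * ((j + 1) ^ r * (j + 1) + (j + 2) ^ r) := by ring
          _ ≤ 2 ^ (r + 2) * ((j + 2) ^ r * (j + 1) + (j + 2) ^ r) := by gcongr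
          _ = _ := by ring
      set m := 2 ^ (r + 2) * (j + 1) ^ (r + 1)
      set l := 2 ^ (r + 1) * (j + 2) ^ r
      obtain ⟨N, hN⟩ := D.exists_card_filter_lt_eq (m := m) (by omega)
      set S := D.filter (· < N) with hS
      set L := D.filter (fun d => ¬ d < N) with hL
      have hLc : 2 * l ≤ L.card := by
        have : S.card + L.card = D.card := D.card_filter_add_card_filter_not (· < N)
        omega
      -- the larger disks that move during `[s, b)`
      classical
      let mv : ℕ → Finset ℕ := fun b => L.filter fun d => ∃ t, s ≤ t ∧ t < b ∧ c (t + 1) d ≠ c t d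
      have hmv : ∀ b, (mv (b + 1)).card ≤ (mv b).card + 1 := by
        intro b
        by_cases hb : ∃ x, c (b + 1) x ≠ c b x
        · obtain ⟨x, hx⟩ := hb
          refine (Finset.card_le_card (t := insert x (mv b)) fun d hd => ?_).trans
            (Finset.card_insert_le _ _)
          simp only [mv, Finset.mem_filter, Finset.mem_insert] at hd ⊢
          obtain ⟨hd, t, h1, h2, h3⟩ := hd
          rcases Nat.lt_succ_iff_lt_or_eq.1 h2 with h | rfl
          · exact Or.inr ⟨hd, t, h1, h, h3⟩
          · exact Or.inl ((hc t).eq_of_ne h3 hx)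
        · push Not at hb
          refine (Finset.card_le_card fun d hd => ?_).trans (Nat.le_succ _)
          simp only [mv, Finset.mem_filter] at hd ⊢
          obtain ⟨hd, t, h1, h2, h3⟩ := hd
          rcases Nat.lt_succ_iff_lt_or_eq.1 h2 with h | rfl
          · exact ⟨hd, t, h1, h, h3⟩
          · exact absurd (hb d) h3
      have hse : s ≤ e := by
        obtain ⟨d, hd⟩ := Finset.card_pos.1 (lt_of_lt_of_le (by positivity) hD)
        obtain ⟨t, h1, h2, -⟩ := hmove d hd
        omega
      -- The number of large disks that have moved grows by at most one per step, so it equals `l`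
      -- at some time `b`. At least `l` other large disks must then move after `b`.
      obtain ⟨b, hsb, hbe, hb⟩ := exists_eq_of_succ_le (f := fun b => (mv b).card) hmv (m := l) hse
        (by
          have : mv s = ∅ := Finset.filter_false_of_mem fun d _ ⟨t, h1, h2, _⟩ => by omega
          simp [this])
        (by
          have : mv e = L :=
            Finset.filter_true_of_mem fun d hd => hmove d (Finset.mem_filter.1 hd).1
          rw [this]; omega)
      have hsub : mv b ⊆ L := Finset.filter_subset _ _
      have hrest : l ≤ (L \ mv b).card := by
        rw [Finset.card_sdiff_of_subset hsub, hb]; omega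
      -- a small disk that rests takes a peg from the larger ones
      have rest : ∀ s' e', s ≤ s' → e' ≤ e → ∀ D' ⊆ L, l ≤ D'.card →
          (∀ d ∈ D', ∃ t, s' ≤ t ∧ t < e' ∧ c (t + 1) d ≠ c t d) →
          ∀ x ∈ S, (¬ ∃ t, s' ≤ t ∧ t < e' ∧ c (t + 1) x ≠ c t x) → s' + 2 ^ (j + 1) ≤ e' := by
        intro s' e' hs' he' D' hD' hl hm x hx hn
        have hxN := (Finset.mem_filter.1 hx).2
        have hxD := (Finset.mem_filter.1 hx).1
        have hx' : ∀ t, s' ≤ t → t ≤ e' → c t x = c s' x := by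
          intro t h1 h2
          by_contra h
          obtain ⟨τ, h3, h4, h5⟩ := exists_move_of_ne h1 h
          exact hn ⟨τ, h3, by omega, h5⟩
        obtain ⟨y, hy⟩ := Finset.card_pos.1 (lt_of_lt_of_le (by positivity) hl)
        obtain ⟨t, h1, h2, -⟩ := hm y hy
        refine ihr (j + 1) (P.erase (c s' x)) D' ?_ hl ?_ hm
        · rw [Finset.card_erase_of_mem (hDP x hxD s' hs' (by omega))]
          omega
        · intro d hd t h1 h2
          have hdL := Finset.mem_filter.1 (hD' hd)
          refine Finset.mem_erase.2 ⟨?_, hDP d hdL.1 t (by omega) (by omega)⟩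
          exact ne_of_forall_eq hc (by omega) hx' (hm d hd) h1 h2
      have hm2 : ∀ d ∈ L \ mv b, ∃ t, b ≤ t ∧ t < e ∧ c (t + 1) d ≠ c t d := by
        intro d hd
        obtain ⟨hd1, hd2⟩ := Finset.mem_sdiff.1 hd
        obtain ⟨t, h1, h2, h3⟩ := hmove d (Finset.mem_filter.1 hd1).1
        refine ⟨t, ?_, h2, h3⟩
        by_contra h
        exact hd2 (Finset.mem_filter.2 ⟨hd1, t, h1, by omega, h3⟩)
      -- If all small disks move both before and after `b`, each half costs `2 ^ j`. Otherwise a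
      -- small disk rests throughout one half, and the large disks moving there lose a peg, so that
      -- half alone costs `2 ^ (j + 1)`.
      by_cases hA : ∀ x ∈ S, ∃ t, s ≤ t ∧ t < b ∧ c (t + 1) x ≠ c t x
      · by_cases hB : ∀ x ∈ S, ∃ t, b ≤ t ∧ t < e ∧ c (t + 1) x ≠ c t x
        · have h1 := ihj P S hP hN.ge
            (fun d hd t h1 h2 => hDP d (Finset.mem_filter.1 hd).1 t h1 (h2.trans hbe)) hA
          have h2 := ihj P S hP hN.ge
            (fun d hd t h1 h2 => hDP d (Finset.mem_filter.1 hd).1 t (hsb.trans h1) h2) hB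
          rw [pow_succ]; omega
        · push Not at hB
          obtain ⟨x, hx, hn⟩ := hB
          have := rest b e hsb le_rfl _ Finset.sdiff_subset hrest hm2 x hx
            (by push Not; exact hn)
          omega
      · push Not at hA
        obtain ⟨x, hx, hn⟩ := hA
        have := rest s b le_rfl hbe _ hsub hb.ge (fun d hd => (Finset.mem_filter.1 hd).2) x hx
          (by push Not; exact hn)
        omega

/-- Starting from all disks on one peg, the disks moved in less than `2 ^ j` moves on `r + 2` pegs
are among the first `2 ^ (r + 1) * (j + 1) ^ r`. -/
theorem eq_of_lt_two_pow {X : Type} [Fintype X] [DecidableEq X] {c : ℕ → ℕ → X}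
    (hc : ∀ t, HanoiStep (c t) (c (t + 1))) {p : X} (h0 : ∀ i, c 0 i = p) {r j n : ℕ}
    (hX : Fintype.card X = r + 2) (hn : n < 2 ^ j) {i : ℕ}
    (hi : 2 ^ (r + 1) * (j + 1) ^ r ≤ i) : c n i = p := by
  by_contra h
  -- If disk `i` ever moves, then at its first move it leaves `p`, so all `i` smaller disks have
  -- already left `p`; there are too many of them for fewer than `2 ^ j` moves.
  obtain ⟨t, -, ht, hm⟩ := exists_move_of_ne (c := c) (d := i) (Nat.zero_le n) (by rwa [h0])
  let Q : ℕ → Prop := fun t => t < n ∧ c (t + 1) i ≠ c t i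
  have hQ : ∃ t, Q t := ⟨t, ht, hm⟩
  classical
  obtain ⟨h1, h2⟩ := Nat.find_spec hQ
  set τ := Nat.find hQ
  have h3 : c τ i = p := by
    by_contra h3
    obtain ⟨t, -, ht, hm⟩ := exists_move_of_ne (c := c) (d := i) (Nat.zero_le τ) (by rwa [h0])
    exact Nat.find_min hQ ht ⟨ht.trans h1, hm⟩
  have := two_pow_le_of_forall_move hc r j (s := 0) (e := n) Finset.univ (Finset.range i)
    (by rw [Finset.card_univ, hX]) (by rwa [Finset.card_range]) (by simp) (by
      intro d hd
      have h4 := (hc τ).ne_of_lt h2 (Finset.mem_range.1 hd)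
      obtain ⟨t, h5, h6, h7⟩ := exists_move_of_ne (c := c) (d := d) (Nat.zero_le τ)
        (by rw [h0, ← h3]; exact h4.1)
      exact ⟨t, h5, h6.trans h1, h7⟩)
  omega

/-! ### The Frame–Stewart strategy -/

/-- `v` is obtained from `u` by `n` moves, some of which may be trivial. -/
inductive HanoiReach {X : Type} : ℕ → (ℕ → X) → (ℕ → X) → Prop
  | refl (u : ℕ → X) : HanoiReach 0 u u
  | tail {n : ℕ} {u v w : ℕ → X} : HanoiReach n u v → HanoiStep v w → HanoiReach (n + 1) u w

namespace HanoiReach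

variable {X : Type} {u v w : ℕ → X} {m n : ℕ}

theorem trans (h : HanoiReach m u v) (h' : HanoiReach n v w) : HanoiReach (m + n) u w := by
  induction h' with
  | refl => exact h
  | tail _ hs ih => exact (ih h).tail hs

theorem mono (h : HanoiReach m u v) (hmn : m ≤ n) : HanoiReach n u v := by
  induction n, hmn using Nat.le_induction with
  | base => exact h
  | succ n _ ih => exact ih.tail (HanoiStep.refl v)

theorem of_step (h : HanoiStep u v) : HanoiReach 1 u v := (HanoiReach.refl u).tail h

/-- Transfer of a tower of `n` consecutive disks, none of the smaller ones being in the way. -/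
theorem tower [DecidableEq X] (r j : ℕ) {n a : ℕ} {P : Finset X} {p q : X} {u : ℕ → X}
    (hP : P.card = r + 2) (hp : p ∈ P) (hq : q ∈ P) (hpq : p ≠ q) (hn : n ≤ j.choose r)
    (ha : ∀ i < a, u i ∉ P) (hu : ∀ i, a ≤ i → i < a + n → u i = p) :
    HanoiReach (4 ^ j) u (fun i => if a ≤ i ∧ i < a + n then q else u i) := by
  induction r generalizing j n a P p q u with
  | zero =>
    refine (of_step ?_).mono (Nat.one_le_pow _ _ (by norm_num))
    rw [Nat.choose_zero_right] at hn
    refine ⟨a, fun e he => if_neg (by omega), fun hne e he => ?_⟩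
    have h1 : 0 < n := by
      by_contra h1
      exact hne (if_neg (by omega))
    simp only
    rw [if_pos (by omega), hu a le_rfl (by omega)]
    exact ⟨fun h => ha e he (h ▸ hp), fun h => ha e he (h ▸ hq)⟩
  | succ r ihr =>
    induction j generalizing n a P p q u with
    | zero =>
      obtain rfl : n = 0 := by simpa using hn
      refine ((HanoiReach.refl u).mono (Nat.zero_le _) : HanoiReach (4 ^ 0) u u).trans
        (n := 0) ?_
      convert HanoiReach.refl u using 2
      exact if_neg (by omega)
    | succ j ihj =>
      -- Pascal's rule: the `m` smallest disks are parked on a spare peg `x` using all of `P`, the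
      -- `l` others go from `p` to `q` without `x`, and the `m` disks follow from `x` to `q`.
      obtain ⟨m, l, rfl, hm, hl⟩ : ∃ m l, n = m + l ∧ m ≤ j.choose (r + 1) ∧ l ≤ j.choose r := by
        rw [Nat.choose_succ_succ, Nat.succ_eq_add_one] at hn
        rcases le_total n (j.choose (r + 1)) with h | h
        · exact ⟨n, 0, rfl, h, Nat.zero_le _⟩
        · exact ⟨j.choose (r + 1), n - j.choose (r + 1), by omega, le_rfl, by omega⟩
      obtain ⟨x, hx⟩ : ((P.erase p).erase q).Nonempty := by
        rw [← Finset.card_pos, Finset.card_erase_of_mem (Finset.mem_erase.2 ⟨hpq.symm, hq⟩),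
          Finset.card_erase_of_mem hp]
        omega
      obtain ⟨hxq, hxp, hxP⟩ : x ≠ q ∧ x ≠ p ∧ x ∈ P := by simpa using hx
      have h1 := ihj (n := m) (a := a) hP hp hxP hxp.symm hm ha
        fun i h1 h2 => hu i h1 (by omega)
      set u1 : ℕ → X := fun i => if a ≤ i ∧ i < a + m then x else u i with hu1
      have h2 := ihr j (n := l) (a := a + m) (P := P.erase x) (p := p) (q := q) (u := u1)
        (by rw [Finset.card_erase_of_mem hxP]; omega) (Finset.mem_erase.2 ⟨hxp.symm, hp⟩)
        (Finset.mem_erase.2 ⟨hxq.symm, hq⟩) hpq hl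
        (by
          intro i hi
          by_cases h : a ≤ i
          · simp [hu1, h, hi]
          · simp only [hu1, h, false_and, if_false]
            exact fun h' => ha i (by omega) (Finset.mem_of_mem_erase h'))
        (by
          intro i h3 h4
          rw [hu1]
          simp only
          rw [if_neg (by omega)]
          exact hu i (by omega) (by omega))
      set u2 : ℕ → X := fun i => if a + m ≤ i ∧ i < a + m + l then q else u1 i with hu2
      have h3 := ihj (n := m) (a := a) (u := u2) hP hxP hq hxq hm
        (by
          intro i hi
          simp only [hu2, hu1]
          rw [if_neg (by omega), if_neg (by omega)]
          exact ha i hi)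
        (by
          intro i h3 h4
          simp only [hu2, hu1]
          rw [if_neg (by omega), if_pos (by omega)])
      -- The three stages cost at most `3 * 4 ^ j ≤ 4 ^ (j + 1)`.
      have h4 := ((h1.trans h2).trans h3).mono (n := 4 ^ (j + 1)) (by rw [pow_succ]; omega)
      convert h4 using 2 with i
      simp only [hu2, hu1]
      split_ifs <;> first | rfl | omega

/-- Every arrangement of the `n` smallest disks is reached from a tower. -/
theorem of_tower [Fintype X] [DecidableEq X] {r j : ℕ} (hX : Fintype.card X = r + 2) (hr : 1 ≤ r)
    (n : ℕ) {p : X} {u v : ℕ → X} (hn : n ≤ j.choose r) (hu : ∀ i < n, u i = p)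
    (huv : ∀ i, n ≤ i → v i = u i) : HanoiReach (n * (2 * 4 ^ j)) u v := by
  induction n generalizing p u with
  | zero =>
    obtain rfl : v = u := funext fun i => huv i (Nat.zero_le i)
    simpa using HanoiReach.refl v
  | succ n ih =>
    -- If the largest disk `n` is misplaced, the tower above it goes to a third peg `x`, which
    -- exists because `1 ≤ r`; then disk `n` moves to its final peg. This costs `4 ^ j + 1 ≤ 2 * 4 ^
    -- j` and leaves a tower of `n` disks on `x`.
    by_cases hp : v n = p
    · refine (ih (by omega) (fun i hi => hu i (by omega)) fun i hi => ?_).mono (by gcongr; omega)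
      rcases hi.eq_or_lt with rfl | hi
      · rw [hp, hu _ (by omega)]
      · exact huv i hi
    · obtain ⟨x, hx⟩ : ((Finset.univ.erase p).erase (v n)).Nonempty := by
        rw [← Finset.card_pos, Finset.card_erase_of_mem (by simpa using hp),
          Finset.card_erase_of_mem (Finset.mem_univ _), Finset.card_univ]
        omega
      obtain ⟨hxv, hxp⟩ : x ≠ v n ∧ x ≠ p := by simpa using hx
      have h1 := tower r j (n := n) (a := 0) (P := Finset.univ) (p := p) (q := x) (u := u)
        (by rw [Finset.card_univ, hX]) (Finset.mem_univ _) (Finset.mem_univ _) hxp.symm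
        (by omega) (by simp) fun i _ hi => hu i (by omega)
      set u1 : ℕ → X := fun i => if 0 ≤ i ∧ i < 0 + n then x else u i with hu1
      have h2 : HanoiStep u1 (Function.update u1 n (v n)) := by
        refine ⟨n, fun e he => Function.update_of_ne he _ _, fun _ e he => ?_⟩
        have h3 : u1 e = x := if_pos (by omega)
        have h4 : u1 n = p := by
          rw [hu1]; simp only; rw [if_neg (by omega)]; exact hu n (by omega)
        rw [h3, h4, Function.update_self]
        exact ⟨hxp, hxv⟩
      have h3 := ih (p := x) (u := Function.update u1 n (v n)) (by omega)
        (by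
          intro i hi
          rw [Function.update_of_ne (by omega)]
          exact if_pos (by omega))
        (by
          intro i hi
          rcases hi.eq_or_lt with rfl | hi
          · rw [Function.update_self]
          · rw [Function.update_of_ne (by omega), huv i hi]
            exact (if_neg (by omega)).symm)
      refine ((h1.tail h2).trans h3).mono ?_
      have : 1 ≤ 4 ^ j := Nat.one_le_pow _ _ (by norm_num)
      rw [add_mul]
      omega

end HanoiReach

/-! ### Generators as moves on infinite words -/

theorem hanoiMap_append_cons {k : ℕ} (π : Equiv.Perm (Fin k)) {w : List (Fin k)} {x : Fin k}
    (hw : ∀ y ∈ w, π y = y) (hx : π x ≠ x) (v : List (Fin k)) :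
    hanoiMap π (w ++ x :: v) = w ++ π x :: v := by
  induction w with
  | nil => simp [hanoiMap, hx]
  | cons y w ih =>
    have hy : π y = y := hw y (by simp)
    simp [hanoiMap, hy, ih fun z hz => hw z (by simp [hz])]

theorem hanoiMap_eq_self {k : ℕ} (π : Equiv.Perm (Fin k)) {w : List (Fin k)}
    (hw : ∀ y ∈ w, π y = y) : hanoiMap π w = w := by
  induction w with
  | nil => rfl
  | cons y w ih =>
    have hy : π y = y := hw y (by simp)
    simp [hanoiMap, hy, ih fun z hz => hw z (by simp [hz])]

namespace Boundary

variable {X : Type}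

theorem mem_take {ξ : Boundary X} {n : ℕ} {x : X} : x ∈ ξ.take n ↔ ∃ i < n, ξ i = x := by
  simp [take]

theorem take_congr {ξ η : Boundary X} {n : ℕ} (h : ∀ i < n, ξ i = η i) : ξ.take n = η.take n := by
  simpa [take] using h

theorem take_succ_add (ξ : Boundary X) (d m : ℕ) : ξ.take (d + 1 + m) =
    ξ.take d ++ ξ d :: (List.range m).map fun i => ξ (d + 1 + i) := by
  simp [take, List.range_add, List.range_succ, Function.comp_def]

end Boundary

/-- `a_π` permutes the first letter that `π` does not fix. -/
theorem hanoiAut_smul_eq {k : ℕ} (π : Equiv.Perm (Fin k)) {ξ η : Boundary (Fin k)} {d : ℕ}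
    (hd : π (ξ d) ≠ ξ d) (h : ∀ e < d, π (ξ e) = ξ e) (hη : η d = π (ξ d))
    (hη' : ∀ e, e ≠ d → η e = ξ e) : hanoiAut π • ξ = η := by
  apply Boundary.ext_take
  intro n
  refine (take_boundaryMap (hanoiAut π) ξ n).trans ?_
  change hanoiMap π (ξ.take n) = _
  rcases le_or_gt n d with hn | hn
  · rw [hanoiMap_eq_self]
    · exact Boundary.take_congr fun i hi => (hη' i (by omega)).symm
    · intro y hy
      obtain ⟨i, hi, rfl⟩ := Boundary.mem_take.1 hy
      exact h i (by omega)
  · obtain ⟨m, rfl⟩ : ∃ m, n = d + 1 + m := Nat.exists_eq_add_of_le hn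
    rw [Boundary.take_succ_add, Boundary.take_succ_add, hanoiMap_append_cons _ _ hd, hη]
    · congr 1
      · exact Boundary.take_congr fun i hi => (hη' i (by omega)).symm
      · congr 1
        exact List.map_congr_left fun i _ => (hη' _ (by omega)).symm
    · intro y hy
      obtain ⟨i, hi, rfl⟩ := Boundary.mem_take.1 hy
      exact h i hi

theorem hanoiAut_smul_eq_self {k : ℕ} (π : Equiv.Perm (Fin k)) (ξ : Boundary (Fin k))
    (h : ∀ e, π (ξ e) = ξ e) : hanoiAut π • ξ = ξ := by
  apply Boundary.ext_take
  intro n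
  refine (take_boundaryMap (hanoiAut π) ξ n).trans (hanoiMap_eq_self π fun y hy => ?_)
  obtain ⟨i, -, rfl⟩ := Boundary.mem_take.1 hy
  exact h i

/-- The first letter in `{i, j}` is the smallest disk on these two pegs. It changes peg, and all
smaller disks avoid both pegs. -/
theorem hanoiStep_smul {k : ℕ} {g : treeAut (Fin k)} (hg : g ∈ hanoiGenSet k)
    (ξ : Boundary (Fin k)) : HanoiStep ξ (g • ξ) := by
  classical
  obtain ⟨i, j, -, rfl⟩ := hg
  by_cases h : ∃ d, Equiv.swap i j (ξ d) ≠ ξ d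
  · have hd := Nat.find_spec h
    have hlt : ∀ e < Nat.find h, Equiv.swap i j (ξ e) = ξ e :=
      fun e he => not_not.1 (Nat.find_min h he)
    set d := Nat.find h
    let η : Boundary (Fin k) := fun e => if e = d then Equiv.swap i j (ξ d) else ξ e
    have hηd : η d = Equiv.swap i j (ξ d) := if_pos rfl
    have hηe : ∀ e, e ≠ d → η e = ξ e := fun e he => if_neg he
    rw [hanoiAut_smul_eq _ hd hlt hηd hηe]
    refine ⟨d, hηe, fun _ e he => ?_⟩
    have h1 := hlt e he
    refine ⟨fun h2 => hd (h2 ▸ h1), fun h2 => ?_⟩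
    rw [hηd] at h2
    rw [h2, Equiv.swap_apply_self] at h1
    exact hd h1.symm
  · push Not at h
    rw [hanoiAut_smul_eq_self _ _ h]
    exact HanoiStep.refl ξ

/-- A nontrivial move is realized by the transposition of its source and target pegs, which fixes
all earlier letters. -/
theorem HanoiStep.exists_smul_eq {k : ℕ} {ξ η : Boundary (Fin k)} (h : HanoiStep ξ η) :
    η = ξ ∨ ∃ g ∈ hanoiGenSet k, g • ξ = η := by
  obtain ⟨d, hd, hd'⟩ := h
  by_cases hne : η d = ξ d
  · left
    funext e
    by_cases he : e = d
    · rw [he, hne]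
    · exact hd e he
  right
  have hmem : ∃ g ∈ hanoiGenSet k, g = hanoiAut (Equiv.swap (ξ d) (η d)) := by
    rcases lt_or_gt_of_ne hne with hlt | hlt
    · exact ⟨_, ⟨_, _, hlt, rfl⟩, by rw [Equiv.swap_comm]⟩
    · exact ⟨_, ⟨_, _, hlt, rfl⟩, rfl⟩
  obtain ⟨g, hg, rfl⟩ := hmem
  refine ⟨_, hg, ?_⟩
  refine hanoiAut_smul_eq _ (d := d) ?_ ?_ ?_ hd
  · rwa [Equiv.swap_apply_left]
  · exact fun e he => Equiv.swap_apply_of_ne_of_ne (hd' hne e he).1 (hd' hne e he).2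
  · rw [Equiv.swap_apply_left]

theorem hanoiGenSet_smul_smul {k : ℕ} {g : treeAut (Fin k)} (hg : g ∈ hanoiGenSet k)
    (ξ : Boundary (Fin k)) : g • g • ξ = ξ := by
  obtain ⟨i, j, -, rfl⟩ := hg
  rw [smul_smul]
  have : hanoiAut (Equiv.swap i j) * hanoiAut (Equiv.swap i j) = 1 := by
    ext1
    refine Equiv.ext fun u => ?_
    exact hanoiMap_inv _ _ (fun x => Equiv.swap_apply_self i j x) u
  rw [this, one_smul]

/-! ### Distances in the Schreier graph as numbers of moves -/

/-- The points of the orbit of `ξ` as vertices of the Schreier graph. -/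
def hanoiWord {k : ℕ} {ξ : Boundary (Fin k)}
    (v : hanoiGroup k ⧸ MulAction.stabilizer (hanoiGroup k) ξ) : Boundary (Fin k) :=
  MulAction.ofQuotientStabilizer (hanoiGroup k) ξ v

theorem hanoiWord_injective {k : ℕ} {ξ : Boundary (Fin k)} :
    Function.Injective (hanoiWord (ξ := ξ)) :=
  MulAction.injective_ofQuotientStabilizer _ _

theorem hanoiWord_one {k : ℕ} (ξ : Boundary (Fin k)) :
    hanoiWord ((1 : hanoiGroup k) : hanoiGroup k ⧸ MulAction.stabilizer (hanoiGroup k) ξ) = ξ :=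
  one_smul (hanoiGroup k) ξ

theorem hanoiStep_of_adj {k : ℕ} {ξ : Boundary (Fin k)}
    {u v : hanoiGroup k ⧸ MulAction.stabilizer (hanoiGroup k) ξ}
    (h : (hanoiSchreierGraph k ξ).Adj u v) : HanoiStep (hanoiWord u) (hanoiWord v) := by
  obtain ⟨-, ⟨s, hs, rfl⟩ | ⟨s, hs, rfl⟩⟩ := (SimpleGraph.fromRel_adj _ _ _).1 h
  · have : hanoiWord (s • u) = (s : treeAut (Fin k)) • hanoiWord u :=
      MulAction.ofQuotientStabilizer_smul _ _ _ _
    rw [this]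
    exact hanoiStep_smul hs _
  · have : hanoiWord (s • v) = (s : treeAut (Fin k)) • hanoiWord v :=
      MulAction.ofQuotientStabilizer_smul _ _ _ _
    rw [this]
    -- The edge is traversed backwards, which is again a move because the generator is an
    -- involution.
    conv_rhs => rw [← hanoiGenSet_smul_smul hs (hanoiWord v)]
    exact hanoiStep_smul hs _

theorem exists_edist_le_of_hanoiReach {k n : ℕ} {ξ η : Boundary (Fin k)}
    (h : HanoiReach n ξ η) : ∃ v, hanoiWord v = η ∧
      (hanoiSchreierGraph k ξ).edist
        ((1 : hanoiGroup k) : hanoiGroup k ⧸ MulAction.stabilizer (hanoiGroup k) ξ) v ≤ n := by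
  induction h with
  | refl => exact ⟨_, hanoiWord_one _, by simp⟩
  | @tail n u v w _ hs ih =>
    obtain ⟨x, hx, hd⟩ := ih
    rcases hs.exists_smul_eq with rfl | ⟨g, hg, rfl⟩
    · exact ⟨x, hx, hd.trans (by exact_mod_cast n.le_succ)⟩
    · let s : hanoiGroup k := ⟨g, Subgroup.subset_closure hg⟩
      refine ⟨s • x, ?_, ?_⟩
      · rw [← hx]
        exact MulAction.ofQuotientStabilizer_smul _ _ s x
      · refine (SimpleGraph.edist_triangle (v := x)).trans ?_
        push_cast
        refine add_le_add hd ?_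
        rw [SimpleGraph.edist_le_one_iff_adj_or_eq]
        by_cases he : x = s • x
        · exact Or.inr he
        · exact Or.inl ((SimpleGraph.fromRel_adj _ _ _).2 ⟨he, Or.inl ⟨s, hg, rfl⟩⟩)

theorem exists_hanoiStep_of_edist_le {k n : ℕ} {ξ : Boundary (Fin k)}
    {v : hanoiGroup k ⧸ MulAction.stabilizer (hanoiGroup k) ξ}
    (h : (hanoiSchreierGraph k ξ).edist
      ((1 : hanoiGroup k) : hanoiGroup k ⧸ MulAction.stabilizer (hanoiGroup k) ξ) v ≤ n) :
    ∃ c : ℕ → ℕ → Fin k, (∀ t, HanoiStep (c t) (c (t + 1))) ∧ c 0 = ξ ∧ c n = hanoiWord v := by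
  obtain ⟨p, hp⟩ := SimpleGraph.exists_walk_of_edist_ne_top
    (ne_top_of_le_ne_top (ENat.natCast_ne_top n) h)
  rw [← hp] at h
  have hl : p.length ≤ n := by exact_mod_cast h
  refine ⟨fun t => hanoiWord (p.getVert t), fun t => ?_, ?_, ?_⟩
  · rcases lt_or_ge t p.length with ht | ht
    · exact hanoiStep_of_adj (p.adj_getVert_succ ht)
    · simp only [p.getVert_of_length_le ht, p.getVert_of_length_le (ht.trans t.le_succ)]
      exact HanoiStep.refl _
  · simp only [SimpleGraph.Walk.getVert_zero]
    exact hanoiWord_one ξ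
  · simp only [p.getVert_of_length_le hl]
    rfl

/-! ### Bounds for the size of balls -/

/-- The arrangements of the `m` smallest disks, all others resting on the peg `p`. -/
def wordsUpTo {X : Type} (p : X) (m : ℕ) : Set (Boundary X) := {w | ∀ i, m ≤ i → w i = p}

/-- The infinite word with prefix `f` and all later letters equal to `p`. -/
def extendWord {X : Type} (p : X) {m : ℕ} (f : Fin m → X) : Boundary X :=
  fun i => if h : i < m then f ⟨i, h⟩ else p

theorem extendWord_injective {X : Type} (p : X) (m : ℕ) :
    Function.Injective (extendWord p (m := m)) := by
  intro f g h
  funext i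
  simpa [extendWord] using congrFun h i

theorem wordsUpTo_eq_range {X : Type} (p : X) (m : ℕ) :
    wordsUpTo p m = Set.range (extendWord p (m := m)) := by
  ext w
  constructor
  · intro hw
    refine ⟨fun i => w i, ?_⟩
    funext i
    by_cases h : i < m
    · simp [extendWord, h]
    · simp [extendWord, h, hw i (by omega)]
  · rintro ⟨f, rfl⟩ i hi
    exact dif_neg (by omega)

theorem finite_wordsUpTo {X : Type} [Finite X] (p : X) (m : ℕ) : (wordsUpTo p m).Finite := by
  rw [wordsUpTo_eq_range]
  exact Set.finite_range _

theorem ncard_wordsUpTo {X : Type} [Fintype X] (p : X) (m : ℕ) :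
    (wordsUpTo p m).ncard = Fintype.card X ^ m := by
  rw [wordsUpTo_eq_range, Set.ncard_range_of_injective (extendWord_injective p m)]
  simp

section Growth

variable {r : ℕ} (p : Fin (r + 2))

theorem hanoiWord_image_ball_subset {n j : ℕ} (hn : n < 2 ^ j) :
    hanoiWord '' {v | (hanoiSchreierGraph (r + 2) (constRay p)).edist
      ((1 : hanoiGroup (r + 2)) : hanoiGroup (r + 2) ⧸ _) v ≤ n} ⊆
      wordsUpTo p (2 ^ (r + 1) * (j + 1) ^ r) := by
  rintro _ ⟨v, hv, rfl⟩ i hi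
  obtain ⟨c, hc, h0, hcn⟩ := exists_hanoiStep_of_edist_le hv
  rw [← hcn]
  exact eq_of_lt_two_pow hc (fun i => by rw [h0]; rfl) (Fintype.card_fin _) hn hi

/-- `Set.ncard` vanishes on infinite sets, so monotonicity and the lower bound for the growth need
finite balls. Here `n < 2 ^ n` allows `j = n`. -/
theorem finite_hanoi_ball (n : ℕ) :
    {v | (hanoiSchreierGraph (r + 2) (constRay p)).edist
      ((1 : hanoiGroup (r + 2)) : hanoiGroup (r + 2) ⧸ _) v ≤ n}.Finite :=
  Set.Finite.of_finite_image
    ((finite_wordsUpTo p _).subset (hanoiWord_image_ball_subset p Nat.lt_two_pow_self))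
    hanoiWord_injective.injOn

theorem hanoiGrowth_mono : Monotone (hanoiGrowth (r + 2) (constRay p)) := fun m n h =>
  Set.ncard_le_ncard (fun _ hv => le_trans (Set.mem_ofPred.1 hv)
    (by exact_mod_cast h : (m : ℕ∞) ≤ n)) (finite_hanoi_ball p n)

theorem hanoiGrowth_le {n j : ℕ} (hn : n < 2 ^ j) :
    hanoiGrowth (r + 2) (constRay p) n ≤ (r + 2) ^ (2 ^ (r + 1) * (j + 1) ^ r) := by
  have h := Set.ncard_le_ncard (hanoiWord_image_ball_subset p hn) (finite_wordsUpTo p _)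
  rwa [Set.ncard_image_of_injective _ hanoiWord_injective, ncard_wordsUpTo,
    Fintype.card_fin] at h

theorem le_hanoiGrowth (hr : 1 ≤ r) (j : ℕ) :
    (r + 2) ^ j.choose r ≤ hanoiGrowth (r + 2) (constRay p) (2 * 8 ^ j) := by
  have h := Set.ncard_le_ncard (s := wordsUpTo p (j.choose r))
    (t := hanoiWord '' {v | (hanoiSchreierGraph (r + 2) (constRay p)).edist
      ((1 : hanoiGroup (r + 2)) : hanoiGroup (r + 2) ⧸ _) v ≤ (2 * 8 ^ j : ℕ)})
    (by
      intro w hw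
      have h1 : HanoiReach (j.choose r * (2 * 4 ^ j)) (constRay p : Boundary (Fin (r + 2))) w :=
        HanoiReach.of_tower (Fintype.card_fin _) hr _ le_rfl (fun _ _ => rfl) hw
      obtain ⟨v, hv, hd⟩ := exists_edist_le_of_hanoiReach (h1.mono (n := 2 * 8 ^ j) (by
        calc _ ≤ 2 ^ j * (2 * 4 ^ j) := Nat.mul_le_mul_right _ (Nat.choose_le_two_pow _ _)
          _ = 2 * 8 ^ j := by rw [show 8 = 2 * 4 from rfl, mul_pow]; ring))
      exact ⟨v, hd, hv⟩)
    ((finite_hanoi_ball p _).image _)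
  rwa [Set.ncard_image_of_injective _ hanoiWord_injective, ncard_wordsUpTo,
    Fintype.card_fin] at h

theorem hanoiGrowth_zero : hanoiGrowth (r + 2) (constRay p) 0 = 1 := by
  simp [hanoiGrowth, ballGrowth]

end Growth

/-! ### Asymptotics -/

/-- With `j = Nat.log 2 n + 1`, the factor `4` absorbs the shift: `2 ^ (j + 1) ≤ 4 * n`, so `(j + 1)
* log 2 ≤ log (4 * n)`. -/
theorem exists_le_rpow_log_pow {γ : ℕ → ℕ} {q r : ℕ} (hq : 2 ≤ q) (h0 : γ 0 = 1)
    (h : ∀ n j, n < 2 ^ j → γ n ≤ q ^ (2 ^ (r + 1) * (j + 1) ^ r)) :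
    ∃ b : ℝ, 1 < b ∧ ∀ n : ℕ, (γ n : ℝ) ≤ b ^ (Real.log (4 * n : ℕ) ^ r) := by
  have hq1 : (1 : ℝ) < q := by exact_mod_cast hq
  have hl2 : 0 < Real.log 2 := Real.log_pos one_lt_two
  have hb : 1 < (q : ℝ) ^ (2 ^ (r + 1) / Real.log 2 ^ r) := Real.one_lt_rpow hq1 (by positivity)
  refine ⟨_, hb, fun n => ?_⟩
  rcases Nat.eq_zero_or_pos n with rfl | hn
  · rw [h0, Nat.cast_one]
    exact Real.one_le_rpow hb.le (pow_nonneg (Real.log_natCast_nonneg _) _)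
  have h1 : (Nat.log 2 n + 2 : ℕ) * Real.log 2 ≤ Real.log (4 * n : ℕ) := by
    rw [← Real.log_pow]
    apply Real.log_le_log (by positivity)
    have := Nat.pow_log_le_self 2 hn.ne'
    exact_mod_cast (show 2 ^ (Nat.log 2 n + 2) ≤ 4 * n by rw [pow_add]; omega)
  have h2 : ((Nat.log 2 n + 2 : ℕ) : ℝ) ^ r ≤ Real.log (4 * n : ℕ) ^ r / Real.log 2 ^ r := by
    rw [← div_pow]
    exact pow_le_pow_left₀ (by positivity) ((le_div_iff₀ hl2).2 h1) r
  calc (γ n : ℝ) ≤ ((q ^ (2 ^ (r + 1) * (Nat.log 2 n + 1 + 1) ^ r) : ℕ) : ℝ) := by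
        exact_mod_cast h n _ (Nat.lt_pow_succ_log_self one_lt_two n)
    _ = (q : ℝ) ^ ((2 : ℝ) ^ (r + 1) * ((Nat.log 2 n + 2 : ℕ) : ℝ) ^ r) := by
        rw [Nat.cast_pow, ← Real.rpow_natCast]
        push_cast
        ring_nf
    _ ≤ (q : ℝ) ^ (2 ^ (r + 1) / Real.log 2 ^ r * Real.log (4 * n : ℕ) ^ r) := by
        refine Real.rpow_le_rpow_of_exponent_le hq1.le ?_
        rw [div_mul_eq_mul_div, mul_div_assoc]
        gcongr
    _ = _ := Real.rpow_mul (by positivity) _ _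

/-- With `i = Nat.log 8 n` and `j = i + r`, one has `j.choose r ≥ (i + 1) ^ r / r!`, while the
radius `2 * 8 ^ j` is at most `2 * 8 ^ r * n`. At `n = 0` the exponent vanishes because `r ≠ 0`. -/
theorem exists_rpow_log_pow_le {γ : ℕ → ℕ} {q r : ℕ} (hq : 2 ≤ q) (hr : r ≠ 0) (hγ : Monotone γ)
    (h0 : γ 0 = 1) (h : ∀ j, q ^ j.choose r ≤ γ (2 * 8 ^ j)) :
    ∃ a : ℝ, 1 < a ∧ ∃ C : ℕ, 0 < C ∧ ∀ n : ℕ, a ^ (Real.log n ^ r) ≤ γ (C * n) := by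
  have hq1 : (1 : ℝ) < q := by exact_mod_cast hq
  have hl : 0 < Real.log 8 := Real.log_pos (by norm_num)
  have hc : 0 < 1 / ((r.factorial : ℝ) * Real.log 8 ^ r) := by positivity
  refine ⟨(q : ℝ) ^ (1 / ((r.factorial : ℝ) * Real.log 8 ^ r)), Real.one_lt_rpow hq1 hc,
    2 * 8 ^ r, by positivity, fun n => ?_⟩
  rcases Nat.eq_zero_or_pos n with rfl | hn
  · simp [h0, hr]
  set i := Nat.log 8 n with hi
  have h1 : Real.log n ≤ (i + 1 : ℕ) * Real.log 8 := by
    rw [← Real.log_pow]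
    apply Real.log_le_log (by positivity)
    exact_mod_cast (Nat.lt_pow_succ_log_self (by norm_num) n).le
  have h2 : Real.log n ^ r ≤ ((i + 1 : ℕ) : ℝ) ^ r * Real.log 8 ^ r := by
    rw [← mul_pow]
    exact pow_le_pow_left₀ (Real.log_natCast_nonneg n) h1 r
  have h3 : ((i + 1 : ℕ) : ℝ) ^ r / r.factorial ≤ (i + r).choose r := by
    have := Nat.pow_le_choose (α := ℝ) r (i + r)
    rwa [show i + r + 1 - r = i + 1 by omega] at this
  calc _ = (q : ℝ) ^ (1 / ((r.factorial : ℝ) * Real.log 8 ^ r) * Real.log n ^ r) :=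
        (Real.rpow_mul (by positivity) _ _).symm
    _ ≤ (q : ℝ) ^ ((i + r).choose r : ℝ) := by
        refine Real.rpow_le_rpow_of_exponent_le hq1.le (le_trans ?_ h3)
        rw [one_div_mul_eq_div, div_le_div_iff₀ (by positivity) (by positivity)]
        calc _ ≤ ((i + 1 : ℕ) : ℝ) ^ r * Real.log 8 ^ r * r.factorial := by gcongr
          _ = _ := by ring
    _ = ((q ^ (i + r).choose r : ℕ) : ℝ) := by rw [Real.rpow_natCast]; push_cast; rfl
    _ ≤ γ (2 * 8 ^ (i + r)) := by exact_mod_cast h _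
    _ ≤ γ (2 * 8 ^ r * n) := by
        have := Nat.pow_log_le_self 8 hn.ne'
        exact_mod_cast hγ (by
          calc 2 * 8 ^ (i + r) = 2 * 8 ^ r * 8 ^ i := by ring
            _ ≤ _ := Nat.mul_le_mul_left _ this)

theorem tendsto_rpow_one_div_of_le {γ : ℕ → ℕ} {r : ℕ} {b : ℝ} (hb : 1 < b) (h1 : ∀ n, 1 ≤ γ n)
    (h : ∀ n : ℕ, (γ n : ℝ) ≤ b ^ (Real.log (4 * n : ℕ) ^ r)) :
    Tendsto (fun n : ℕ => (γ n : ℝ) ^ (1 / (n : ℝ))) atTop (𝓝 1) := by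
  have hlim : Tendsto (fun n : ℕ => Real.log (4 * n : ℕ) ^ r * (1 / (n : ℝ))) atTop (𝓝 0) := by
    have h4 : Tendsto (fun n : ℕ => ((4 * n : ℕ) : ℝ)) atTop atTop :=
      tendsto_natCast_atTop_atTop.comp (tendsto_id.const_mul_atTop' (by norm_num))
    have := ((Real.isLittleO_pow_log_id_atTop (n := r)).tendsto_div_nhds_zero.comp h4).const_mul 4
    rw [mul_zero] at this
    refine this.congr fun n => ?_
    simp only [Function.comp, id]
    push_cast
    rw [mul_one_div, ← mul_div_assoc, mul_div_mul_left _ _ four_ne_zero]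
  have hup : Tendsto (fun n : ℕ => b ^ (Real.log (4 * n : ℕ) ^ r * (1 / (n : ℝ)))) atTop (𝓝 1) := by
    have := (Real.continuousAt_const_rpow (a := b) (b := 0) (by positivity)).tendsto.comp hlim
    rwa [Real.rpow_zero] at this
  refine tendsto_of_tendsto_of_tendsto_of_le_of_le tendsto_const_nhds hup (fun n => ?_) fun n => ?_
  · exact Real.one_le_rpow (by exact_mod_cast h1 n) (by positivity)
  · change (γ n : ℝ) ^ (1 / (n : ℝ)) ≤ _
    rw [Real.rpow_mul (by positivity)]
    exact Real.rpow_le_rpow (by positivity) (h n) (by positivity)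

theorem asympLE_rpow_of_le {γ : ℕ → ℕ} {r C : ℕ} {a : ℝ} (ha : 1 < a) (hr : 2 ≤ r) (hC : 0 < C)
    (h : ∀ n : ℕ, a ^ (Real.log n ^ r) ≤ γ (C * n)) {m : ℝ} (hm : 0 < m) :
    AsympLE (fun n : ℕ => (n : ℝ) ^ m) (fun n => γ n) := by
  have hla := Real.log_pos ha
  -- Rescaling by `K` makes `L = log (K * n)` at least `1` and `m / log a` for every `n ≥ 1`, so `m
  -- * log n ≤ (log a * L) * L`; this is where `2 ≤ r` enters.
  obtain ⟨K, hK⟩ := exists_nat_ge (Real.exp (max 1 (m / Real.log a)))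
  have hK0 : (0 : ℝ) < K := (Real.exp_pos _).trans_le hK
  refine ⟨C * K, Nat.mul_pos hC (by exact_mod_cast hK0), fun n => ?_⟩
  rcases Nat.eq_zero_or_pos n with rfl | hn
  · simp [Real.zero_rpow hm.ne']
  have hn1 : (1 : ℝ) ≤ n := by exact_mod_cast hn
  have hn0 : (0 : ℝ) < n := by positivity
  have hln : 0 ≤ Real.log n := Real.log_natCast_nonneg n
  have hlK : max 1 (m / Real.log a) ≤ Real.log K := (Real.le_log_iff_exp_le hK0).2 hK
  have hlog : Real.log (K * n : ℕ) = Real.log K + Real.log n := by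
    push_cast
    exact Real.log_mul hK0.ne' hn0.ne'
  set L := Real.log (K * n : ℕ)
  have hL1 : 1 ≤ L := by have := le_max_left 1 (m / Real.log a); linarith
  have hLm : m / Real.log a ≤ L := by have := le_max_right 1 (m / Real.log a); linarith
  have key : m * Real.log n ≤ Real.log a * L ^ r := by
    calc m * Real.log n ≤ (Real.log a * L) * L := by
          rw [div_le_iff₀ hla] at hLm
          have : Real.log n ≤ L := by have := le_max_left 1 (m / Real.log a); linarith
          gcongr
          linarith
      _ = Real.log a * L ^ 2 := by ring
      _ ≤ _ := by gcongr
  calc (n : ℝ) ^ m = Real.exp (Real.log n * m) := Real.rpow_def_of_pos hn0 m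
    _ ≤ Real.exp (Real.log a * L ^ r) := Real.exp_le_exp.2 (by linarith)
    _ = a ^ (L ^ r) := (Real.rpow_def_of_pos (by linarith) _).symm
    _ ≤ γ (C * (K * n)) := h (K * n)
    _ = _ := by rw [mul_assoc]

theorem mainTheorem2 (k : ℕ) (hk : 4 ≤ k) :
    IntermediateGrowth (fun n : ℕ => (hanoiGrowth k (constRay ⟨0, by omega⟩) n : ℝ)) ∧
      ∃ a b : ℝ, 1 < a ∧ a < b ∧
        AsympLE (fun n : ℕ => a ^ (Real.log (n : ℝ) ^ (k - 2)))
          (fun n : ℕ => (hanoiGrowth k (constRay ⟨0, by omega⟩) n : ℝ)) ∧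
        AsympLE (fun n : ℕ => (hanoiGrowth k (constRay ⟨0, by omega⟩) n : ℝ))
          (fun n : ℕ => b ^ (Real.log (n : ℝ) ^ (k - 2))) := by
  obtain ⟨r, rfl⟩ : ∃ r, k = r + 2 := ⟨k - 2, by omega⟩
  rw [Nat.add_sub_cancel]
  set p : Fin (r + 2) := ⟨0, by omega⟩
  have h0 := hanoiGrowth_zero p
  have hmono := hanoiGrowth_mono p
  obtain ⟨b, hb, hub⟩ := exists_le_rpow_log_pow (γ := hanoiGrowth (r + 2) (constRay p))
    (q := r + 2) (r := r) (by omega) h0 fun n j hn => hanoiGrowth_le p hn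
  obtain ⟨a, ha, C, hC, hlb⟩ := exists_rpow_log_pow_le (q := r + 2) (r := r) (by omega) (by omega)
    hmono h0 fun j => le_hanoiGrowth p (by omega) j
  -- The upper base is enlarged to `max b (a + 1)` to secure `a < b`.
  refine ⟨⟨tendsto_rpow_one_div_of_le hb (fun n => h0 ▸ hmono n.zero_le) hub,
    fun m hm => asympLE_rpow_of_le ha (by omega) hC hlb hm⟩, a, max b (a + 1), ha,
    lt_max_of_lt_right (lt_add_one a), ⟨C, hC, hlb⟩, 4, by norm_num, fun n => (hub n).trans ?_⟩
  exact Real.rpow_le_rpow (by linarith) (le_max_left _ _)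
    (pow_nonneg (Real.log_natCast_nonneg _) _)
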